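/- Let $S$ be a finite set and let $(m(s,t))_{s,t\in S}$ be a Coxeter matrix: $m(s,s)=1$ and $2\le m(s,t)=m(t,s)\le\infty$ for $s\ne t$; let $(W,S)$ be the corresponding Coxeter group. Call $s,t\in S$ concurrent, written $s\,\mathcal C\,t$, if $m(s,t)\neq 2$. A labelled heap is a finite (possibly empty) poset $(E,\le)$ with a map $\varepsilon:E\to S$ such that any $\alpha,\beta\in E$ with $\varepsilon(\alpha)\,\mathcal C\,\varepsilon(\beta)$ are comparable and such that $\le$ is the transitive closure of the relation "$\alpha\le\beta$ and $\varepsilon(\alpha)\,\mathcal C\,\varepsilon(\beta)$". A heap is a labelled heap up to label-preserving poset isomorphism. A heap $E$ is called the heap of a fully commutative element of $W$ if 1. there is no convex chain $\alpha_1<\alpha_2<\dots<\alpha_m$ in $E$ with $\varepsilon(\alpha_i)=s$ for all odd $i$ and $\varepsilon(\alpha_i)=t$ for all even $i$, where $3\le m=m(s,t)<\infty$ (a chain is convex if it contains every $\gamma\in E$ lying strictly between two of its members); and 2. there is no covering relation $\alpha<\beta$ in $E$ with $\varepsilon(\alpha)=\varepsilon(\beta)$. (Such heaps are in bijection with the fully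 commutative elements of $W$.) The Coxeter group $(W,S)$ is FC-finite if there are only finitely many such heaps. A heap $E$ is ranked if there is a function $\rho:E\to\mathbb Z$ with $\rho(b)=\rho(a)+1$ whenever $a<b$ is a covering relation. For $a\le b$ in $E$ let $[a,b]=\{x\in E: a\le x\le b\}$. This is a minimal balanced subinterval if $\varepsilon(a)=\varepsilon(b)$, $a\neq b$, and the only elements $c\in[a,b]$ with $\varepsilon(c)=\varepsilon(a)$ are $a$ and $b$. In that case put $$S_{[a,b]}=\{c\in[a,b] : \varepsilon(c)\neq\varepsilon(a)\text{ and }\varepsilon(a)\,\mathcal C\,\varepsilon(c)\}.$$ **Theorem.** Let $(W,S)$ be an FC-finite Coxeter group and let $E$ be the heap of a fully commutative element of $W$. The following are equivalent: (i) $E$ is ranked; (ii) for each minimal balanced subinterval $[a,b]$ of $E$, either (a) all the elements of $S_{[a,b]}$ have the same label, or (b) the elements of $S_{[a,b]}$ have pairwise distinct labels. -/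

import Mathlib

universe u v

/-- A labelled heap with pieces in `P` and concurrency relation `C`: a finite poset with a labelling
in `P` such that elements with concurrent labels are comparable and the order is the transitive
closure of its restriction to pairs with concurrent labels. In use, `C` is reflexive and symmetric;
see `CoxeterMatrix.concurrent_refl` and `CoxeterMatrix.concurrent_symm`. -/
structure LabelledHeap (P : Type u) (C : P → P → Prop) : Type (max u (v + 1)) where
  /-- The underlying set. -/
  carrier : Type v
  [order : PartialOrder carrier]
  [finite : Finite carrier]
  /-- The labelling map. -/
  label : carrier → P
  comparable : ∀ x y : carrier, C (label x) (label y) → x ≤ y ∨ y ≤ x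
  le_iff_transGen : ∀ x y : carrier,
    x ≤ y ↔ Relation.TransGen (fun p q => p ≤ q ∧ C (label p) (label q)) x y

attribute [instance] LabelledHeap.order LabelledHeap.finite

namespace LabelledHeap

/-- Isomorphism of labelled heaps: an order isomorphism that preserves labels. -/
def IsIso {P : Type u} {C : P → P → Prop} (E F : LabelledHeap.{u, v} P C) : Prop :=
  ∃ φ : E.carrier ≃o F.carrier, ∀ x, F.label (φ x) = E.label x

/-- Isomorphism is an equivalence relation on labelled heaps. -/
def isoSetoid (P : Type u) (C : P → P → Prop) : Setoid (LabelledHeap.{u, v} P C) where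
  r := IsIso
  iseqv :=
    { refl := fun E => ⟨OrderIso.refl E.carrier, fun _ => rfl⟩
      symm := fun {E F} h => by
        obtain ⟨φ, hφ⟩ := h
        exact ⟨φ.symm, fun x => by rw [← hφ, OrderIso.apply_symm_apply]⟩
      trans := fun {E F G} h k => by
        obtain ⟨φ, hφ⟩ := h
        obtain ⟨ψ, hψ⟩ := k
        exact ⟨φ.trans ψ, fun x => by rw [OrderIso.trans_apply, hψ, hφ]⟩ }

/-- `ρ` is a rank function if it increases by one along every covering relation. -/
def IsRankFunction {P : Type u} {C : P → P → Prop} (E : LabelledHeap.{u, v} P C)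
    (ρ : E.carrier → ℤ) : Prop :=
  ∀ a b : E.carrier, a ⋖ b → ρ b = ρ a + 1

/-- A heap is ranked if it has a rank function. -/
def IsRanked {P : Type u} {C : P → P → Prop} (E : LabelledHeap.{u, v} P C) : Prop :=
  ∃ ρ : E.carrier → ℤ, E.IsRankFunction ρ

/-- The interval `[a, b]` is a balanced subinterval: its endpoints have the same label. -/
def IsBalanced {P : Type u} {C : P → P → Prop} (E : LabelledHeap.{u, v} P C)
    (a b : E.carrier) : Prop :=
  a ≤ b ∧ E.label a = E.label b

/-- The balanced subinterval `[a, b]` is minimal: `a ≠ b`, and only its endpoints carry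
the label of `a`. -/
def IsMinimalBalanced {P : Type u} {C : P → P → Prop} (E : LabelledHeap.{u, v} P C)
    (a b : E.carrier) : Prop :=
  E.IsBalanced a b ∧ a ≠ b ∧ ∀ c ∈ Set.Icc a b, E.label c = E.label a → c = a ∨ c = b

/-- The set `S_{[a, b]}` of elements of `[a, b]` whose label is concurrent with, but different from,
the label of `a`. -/
def concurrentSet {P : Type u} {C : P → P → Prop} (E : LabelledHeap.{u, v} P C)
    (a b : E.carrier) : Set E.carrier :=
  {c | c ∈ Set.Icc a b ∧ E.label a ≠ E.label c ∧ C (E.label a) (E.label c)}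

/-- A chain `β₀ < β₁ < ⋯` is convex if it contains every element that lies strictly between
two of its members. -/
def IsConvexChain {P : Type u} {C : P → P → Prop} (E : LabelledHeap.{u, v} P C) {r : ℕ}
    (β : Fin r → E.carrier) : Prop :=
  StrictMono β ∧ ∀ (c : E.carrier) (i j : Fin r), β i < c → c < β j → c ∈ Set.range β

end LabelledHeap

/-- A heap: an isomorphism class of labelled heaps. -/
def HeapClass (P : Type u) (C : P → P → Prop) : Type (max u (v + 1)) :=
  Quotient (LabelledHeap.isoSetoid.{u, v} P C)

namespace CoxeterMatrix

/-- The concurrency relation of a Coxeter group with Coxeter matrix `M`: `m(s, t) ≠ 2`.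
The entry `0` of `M` encodes `m(s, t) = ∞`. -/
def Concurrent {S : Type u} (M : CoxeterMatrix S) (s t : S) : Prop := M s t ≠ 2

theorem concurrent_refl {S : Type u} (M : CoxeterMatrix S) (s : S) : M.Concurrent s s := by
  unfold Concurrent
  rw [M.diagonal s]
  decide

theorem concurrent_symm {S : Type u} (M : CoxeterMatrix S) {s t : S} (h : M.Concurrent s t) :
    M.Concurrent t s := by
  unfold Concurrent at *
  rwa [M.symmetric t s]

/-- `E` is the heap of a fully commutative element of the Coxeter group with matrix `M`:
there is no convex chain of length `m(s, t)` labelled `s, t, s, …` where `3 ≤ m(s, t) < ∞`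
(positions are counted from `0` here, and `3 ≤ M s t` excludes the code `0` of `∞`), and no
covering relation between elements with equal labels. -/
structure IsFullyCommutativeHeap {S : Type u} (M : CoxeterMatrix S)
    (E : LabelledHeap.{u, v} S M.Concurrent) : Prop where
  no_braid : ∀ s t : S, 3 ≤ M s t → ¬ ∃ β : Fin (M s t) → E.carrier,
    E.IsConvexChain β ∧ ∀ i : Fin (M s t), E.label (β i) = if Even (i : ℕ) then s else t
  no_square : ¬ ∃ a b : E.carrier, a ⋖ b ∧ E.label a = E.label b

/-- The Coxeter group with matrix `M` is FC-finite: there are only finitely many heaps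
(up to isomorphism) of fully commutative elements. As heaps are finite, carriers in `Type`
represent all isomorphism classes. -/
def FCFinite {S : Type u} (M : CoxeterMatrix S) : Prop :=
  {h : HeapClass.{u, 0} S M.Concurrent |
    ∃ E : LabelledHeap.{u, 0} S M.Concurrent,
      M.IsFullyCommutativeHeap E ∧ Quotient.mk (LabelledHeap.isoSetoid S M.Concurrent) E = h}.Finite

end CoxeterMatrix

/-! FC-finiteness restricts the Coxeter graph. Follow an infinite walk in the graph that never
backtracks, except at a turn: a passage from `b` to several commuting neighbours at once, or to one
neighbour `x` with m(b,x) ≠ 3, and back to `b`. Its initial segments are heaps of fully commutative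
elements, of unbounded size. So in the FC-finite case the graph has no cycle
(`isAcyclic_of_fcFinite`), and no vertex has two edges that both lead, without backtracking, to a
turn (`not_fcFinite_of_leadsToTurn`).

(i) ⇒ (ii): if two elements of S_[a,b] share a label, the edge from the label of `a` to it leads to
a turn (`leadsToTurn`), and the rank rises by at least 3 from `a` to `b`. An element of S_[a,b] with
another label cannot have its label repeated, as that would give a second edge leading to a turn.
Acyclicity then makes it cover `a` and be covered by `b` (`covBy_of_forall_between`), so the rank
rises by exactly 2, a contradiction.

(ii) ⇒ (i): only acyclicity is needed. The rank function is built by adding one maximal element `b`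
at a time, which works once the rank is constant on the elements covered by `b`
(`exists_constant_on_covered`). If the label of `b` has occurred before, this follows from (a) or
(b) for the interval from its last occurrence to `b`. If not, deleting that label from the graph
separates the labels of the covered elements, and ranks can be shifted on each component
independently. -/

/-! ### Heaps generated by a time function -/

namespace LabelledHeap

/-- The labelled heap on a finite type `X` with labels `f` and times `τ`, whose order is generated by
the pairs with concurrent labels and increasing times. -/
def ofTime {P : Type u} {C : P → P → Prop} (hrefl : ∀ p, C p p) (hsymm : ∀ p q, C p q → C q p)
    (X : Type v) [Finite X] (τ : X → ℕ) (f : X → P)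
    (h : ∀ x y, C (f x) (f y) → τ x = τ y → x = y) : LabelledHeap.{u, v} P C :=
  have key : ∀ x y, Relation.ReflTransGen (fun x y => τ x < τ y ∧ C (f x) (f y)) x y →
      x = y ∨ τ x < τ y := by
    intro x y hxy
    induction hxy with
    | refl => exact Or.inl rfl
    | tail _ h2 ih =>
      rcases ih with rfl | ih
      · exact Or.inr h2.1
      · exact Or.inr (ih.trans h2.1)
  letI : PartialOrder X :=
    { le := Relation.ReflTransGen (fun x y => τ x < τ y ∧ C (f x) (f y))
      le_refl := fun _ => Relation.ReflTransGen.refl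
      le_trans := fun _ _ _ => Relation.ReflTransGen.trans
      le_antisymm := fun x y h1 h2 => by
        rcases key x y h1 with h3 | h3
        · exact h3
        · rcases key y x h2 with h4 | h4
          · exact h4.symm
          · omega }
  { carrier := X
    label := f
    comparable := fun x y hxy => by
      rcases lt_trichotomy (τ x) (τ y) with h1 | h1 | h1
      · exact Or.inl (Relation.ReflTransGen.single ⟨h1, hxy⟩)
      · exact Or.inl (h x y hxy h1 ▸ Relation.ReflTransGen.refl)
      · exact Or.inr (Relation.ReflTransGen.single ⟨h1, hsymm _ _ hxy⟩)
    le_iff_transGen := fun x y => by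
      constructor
      · intro hxy
        have hxy' : Relation.ReflTransGen (fun x y => τ x < τ y ∧ C (f x) (f y)) x y := hxy
        induction hxy' with
        | refl => exact Relation.TransGen.single ⟨le_rfl, hrefl _⟩
        | tail h1 h2 ih => exact (ih h1).tail ⟨Relation.ReflTransGen.single h2, h2.2⟩
      · intro hxy
        induction hxy with
        | single h1 => exact h1.1
        | tail _ h2 ih => exact ih.trans h2.1 }

section ofTime

variable {P : Type u} {C : P → P → Prop} {hrefl : ∀ p, C p p} {hsymm : ∀ p q, C p q → C q p}
  {X : Type v} [Finite X] {τ : X → ℕ} {f : X → P} {h : ∀ x y, C (f x) (f y) → τ x = τ y → x = y}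

theorem ofTime_lt_of_time_lt {x y : X} (hτ : τ x < τ y) (hC : C (f x) (f y)) :
    (show (ofTime hrefl hsymm X τ f h).carrier from x) <
      (show (ofTime hrefl hsymm X τ f h).carrier from y) := by
  refine lt_of_le_of_ne (Relation.ReflTransGen.single ⟨hτ, hC⟩) ?_
  intro hxy
  have : x = y := hxy
  subst this
  exact lt_irrefl _ hτ

theorem ofTime_time_lt_of_lt {x y : (ofTime hrefl hsymm X τ f h).carrier} (hlt : x < y) :
    τ x < τ y := by
  have hle : Relation.ReflTransGen (fun x y => τ x < τ y ∧ C (f x) (f y)) x y := hlt.le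
  have key : x = y ∨ τ x < τ y := by
    clear hlt
    induction hle with
    | refl => exact Or.inl rfl
    | tail _ h2 ih =>
      rcases ih with ih | ih
      · exact Or.inr (by rw [ih]; exact h2.1)
      · exact Or.inr (ih.trans h2.1)
  exact key.resolve_left hlt.ne

end ofTime

end LabelledHeap

/-! ### Block sequences and their heaps -/

namespace CoxeterMatrix

/-- The Coxeter graph of `M` without its edge labels. -/
def coxeterGraph {S : Type u} (M : CoxeterMatrix S) : SimpleGraph S where
  Adj s t := s ≠ t ∧ M.Concurrent s t
  symm := ⟨fun _ _ h => ⟨h.1.symm, M.concurrent_symm h.2⟩⟩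
  loopless := ⟨fun _ h => h.1 rfl⟩

/-- A sequence of blocks of commuting generators, consecutive blocks being adjacent, in which every
immediate repetition of a generator is separated by two generators or is of the form `s t s` with
`m(s, t) ≠ 3`, not followed by `t`. -/
structure IsBlockSequence {S : Type u} (M : CoxeterMatrix S) (A : ℕ → Set S) : Prop where
  nonempty : ∀ n, (A n).Nonempty
  adj : ∀ n, ∀ s ∈ A n, ∀ t ∈ A (n + 1), M.coxeterGraph.Adj s t
  commute : ∀ n, ∀ s ∈ A n, ∀ t ∈ A n, s ≠ t → ¬ M.Concurrent s t
  turn : ∀ n, ∀ s ∈ A n, s ∈ A (n + 2) →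
    (A (n + 1)).Nontrivial ∨ ∃ t ∈ A (n + 1), M s t ≠ 3 ∧ t ∉ A (n + 3)

/-- The heap of the first `N` blocks of a block sequence. -/
noncomputable def blockHeap {S : Type u} [Finite S] (M : CoxeterMatrix S) {A : ℕ → Set S}
    (hA : M.IsBlockSequence A) (N : ℕ) : LabelledHeap.{u, 0} S M.Concurrent :=
  LabelledHeap.ofTime M.concurrent_refl (fun _ _ => M.concurrent_symm)
    -- Generators are coded by `Fin (Nat.card S)` so that the carrier lies in `Type`, as `FCFinite`
    -- requires.
    {p : Fin N × Fin (Nat.card S) // (Finite.equivFin S).symm p.2 ∈ A p.1}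
    (fun p => p.1.1) (fun p => (Finite.equivFin S).symm p.1.2) (by
      rintro ⟨⟨i, s⟩, hs⟩ ⟨⟨j, t⟩, ht⟩ hC hij
      simp only at hs ht hC hij
      obtain rfl : i = j := Fin.ext hij
      by_contra hne
      refine hA.commute i _ hs _ ht (fun h => hne ?_) hC
      obtain rfl : s = t := (Finite.equivFin S).symm.injective h
      rfl)

section blockHeap

variable {S : Type u} [Finite S] {M : CoxeterMatrix S} {A : ℕ → Set S}

/-- The index of the block of an element of `blockHeap`. -/
def blockTime (hA : M.IsBlockSequence A) {N : ℕ} (x : (M.blockHeap hA N).carrier) : ℕ :=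
  (x : {p : Fin N × Fin (Nat.card S) // (Finite.equivFin S).symm p.2 ∈ A p.1}).1.1

theorem blockTime_lt (hA : M.IsBlockSequence A) {N : ℕ} (x : (M.blockHeap hA N).carrier) :
    blockTime hA x < N :=
  (x : {p : Fin N × Fin (Nat.card S) // (Finite.equivFin S).symm p.2 ∈ A p.1}).1.1.2

theorem label_mem_block (hA : M.IsBlockSequence A) {N : ℕ} (x : (M.blockHeap hA N).carrier) :
    (M.blockHeap hA N).label x ∈ A (blockTime hA x) :=
  (x : {p : Fin N × Fin (Nat.card S) // (Finite.equivFin S).symm p.2 ∈ A p.1}).2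

theorem exists_blockHeap_element (hA : M.IsBlockSequence A) {N n : ℕ} (hn : n < N) {s : S}
    (hs : s ∈ A n) :
    ∃ x : (M.blockHeap hA N).carrier, blockTime hA x = n ∧ (M.blockHeap hA N).label x = s :=
  ⟨⟨(⟨n, hn⟩, Finite.equivFin S s), by simpa using hs⟩, rfl, (Finite.equivFin S).symm_apply_apply s⟩

theorem blockHeap_lt (hA : M.IsBlockSequence A) {N : ℕ} {x y : (M.blockHeap hA N).carrier}
    (h : blockTime hA x < blockTime hA y)
    (hC : M.Concurrent ((M.blockHeap hA N).label x) ((M.blockHeap hA N).label y)) : x < y :=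
  LabelledHeap.ofTime_lt_of_time_lt h hC

theorem blockTime_lt_of_lt (hA : M.IsBlockSequence A) {N : ℕ} {x y : (M.blockHeap hA N).carrier}
    (h : x < y) : blockTime hA x < blockTime hA y :=
  LabelledHeap.ofTime_time_lt_of_lt h

/-- Between two elements with the same label there are the blocks next to them. -/
theorem exists_between (hA : M.IsBlockSequence A) {N : ℕ} {x y : (M.blockHeap hA N).carrier}
    (hlt : x < y) (hl : (M.blockHeap hA N).label x = (M.blockHeap hA N).label y) :
    (∀ t ∈ A (blockTime hA x + 1), ∃ z, x < z ∧ z < y ∧ blockTime hA z = blockTime hA x + 1 ∧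
      (M.blockHeap hA N).label z = t) ∧
    ∃ z, x < z ∧ z < y ∧ blockTime hA z + 1 = blockTime hA y := by
  have hτ := blockTime_lt_of_lt hA hlt
  have hx := label_mem_block hA x
  have hy := label_mem_block hA y
  have hy' := blockTime_lt hA y
  have hne : blockTime hA x + 1 ≠ blockTime hA y := by
    intro h
    exact (hA.adj _ _ hx _ (h ▸ hy)).1 hl
  constructor
  · intro t ht
    have hadj := hA.adj _ _ hx _ ht
    obtain ⟨z, hz, rfl⟩ := exists_blockHeap_element hA (N := N) (n := blockTime hA x + 1)
      (by omega) ht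
    exact ⟨z, blockHeap_lt hA (by omega) hadj.2,
      blockHeap_lt hA (by omega) (hl ▸ M.concurrent_symm hadj.2), hz, rfl⟩
  · obtain ⟨j, hj⟩ : ∃ j, j + 1 = blockTime hA y := ⟨blockTime hA y - 1, by omega⟩
    obtain ⟨t, ht⟩ := hA.nonempty j
    have hadj := hA.adj _ _ ht _ (hj ▸ hy)
    obtain ⟨z, hz, rfl⟩ := exists_blockHeap_element hA (N := N) (n := j) (by omega) ht
    exact ⟨z, blockHeap_lt hA (by omega) (hl ▸ M.concurrent_symm hadj.2),
      blockHeap_lt hA (by omega) hadj.2, by omega⟩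

/-- In a convex chain `x < y < z` whose ends have equal labels the times are consecutive and `y` is
alone in its block. -/
theorem times_of_unique_between (hA : M.IsBlockSequence A) {N : ℕ}
    {x y z : (M.blockHeap hA N).carrier} (hlt : x < z)
    (hl : (M.blockHeap hA N).label x = (M.blockHeap hA N).label z)
    (hu : ∀ w, x < w → w < z → w = y) :
    blockTime hA y = blockTime hA x + 1 ∧ blockTime hA z = blockTime hA x + 2 ∧
      ∀ t ∈ A (blockTime hA x + 1), t = (M.blockHeap hA N).label y := by
  obtain ⟨h1, w, hxw, hwz, hw⟩ := exists_between hA hlt hl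
  obtain rfl := hu w hxw hwz
  have h2 : ∀ t ∈ A (blockTime hA x + 1),
      blockTime hA w = blockTime hA x + 1 ∧ (M.blockHeap hA N).label w = t := by
    intro t ht
    obtain ⟨w', h3, h4, h5, h6⟩ := h1 t ht
    obtain rfl := hu w' h3 h4
    exact ⟨h5, h6⟩
  obtain ⟨t, ht⟩ := hA.nonempty (blockTime hA x + 1)
  have h3 := (h2 t ht).1
  exact ⟨h3, by omega, fun t ht => (h2 t ht).2.symm⟩

/-- The first three members of a forbidden chain occupy consecutive blocks, the middle block being a
singleton. The `turn` condition then gives m(s,t) ≠ 3, so there is a fourth member; it lies in the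
next block, which the same condition forbids. -/
theorem isFullyCommutativeHeap_blockHeap (hA : M.IsBlockSequence A) (N : ℕ) :
    M.IsFullyCommutativeHeap (M.blockHeap hA N) where
  no_square := by
    rintro ⟨a, b, hab, hl⟩
    obtain ⟨-, z, h1, h2, -⟩ := exists_between hA hab.lt hl
    exact hab.2 h1 h2
  no_braid := by
    rintro s t hm ⟨β, ⟨hmono, hconv⟩, hlab⟩
    have uniq : ∀ (i : ℕ) (hi : i + 2 < M s t) (w), β ⟨i, by omega⟩ < w → w < β ⟨i + 2, hi⟩ →
        w = β ⟨i + 1, by omega⟩ := by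
      intro i hi w h1 h2
      obtain ⟨k, rfl⟩ := hconv w _ _ h1 h2
      have h3 : i < k.1 := hmono.lt_iff_lt.1 h1
      have h4 : k.1 < i + 2 := hmono.lt_iff_lt.1 h2
      congr 1
      exact Fin.ext (by simp only; omega)
    have l0 := hlab ⟨0, by omega⟩
    have l1 := hlab ⟨1, by omega⟩
    have l2 := hlab ⟨2, by omega⟩
    simp at l0 l1 l2
    obtain ⟨h1, h2, h3⟩ := times_of_unique_between hA (y := β ⟨1, by omega⟩)
      (hmono (show (⟨0, by omega⟩ : Fin (M s t)) < ⟨2, by omega⟩ from by simp [Fin.lt_def]))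
      (by rw [l0, l2]) (uniq 0 (by omega))
    have m0 := label_mem_block hA (β ⟨0, by omega⟩)
    have m2 := label_mem_block hA (β ⟨2, by omega⟩)
    rw [l0] at m0
    rw [l2, h2] at m2
    rw [l1] at h3
    rcases hA.turn _ s m0 m2 with ⟨u, hu, u', hu', hne⟩ | ⟨u, hu, hm3, hnot⟩
    · exact hne ((h3 u hu).trans (h3 u' hu').symm)
    · obtain rfl := h3 u hu
      have l3 := hlab ⟨3, by omega⟩
      have h33 : ¬ Even 3 := by decide
      simp only [h33, if_false] at l3
      obtain ⟨-, h4, -⟩ := times_of_unique_between hA (y := β ⟨2, by omega⟩)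
        (hmono (show (⟨1, by omega⟩ : Fin (M s u)) < ⟨3, by omega⟩ from by simp [Fin.lt_def]))
        (by rw [l1, l3]) (uniq 1 (by omega))
      have m3 := label_mem_block hA (β ⟨3, by omega⟩)
      rw [l3, h4, h1] at m3
      exact hnot m3

theorem le_card_blockHeap (hA : M.IsBlockSequence A) (N : ℕ) :
    N ≤ Nat.card (M.blockHeap hA N).carrier := by
  have : ∀ n : Fin N, ∃ x : (M.blockHeap hA N).carrier, blockTime hA x = n := fun n => by
    obtain ⟨s, hs⟩ := hA.nonempty n
    obtain ⟨x, hx, -⟩ := exists_blockHeap_element hA n.2 hs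
    exact ⟨x, hx⟩
  choose g hg using this
  have hinj : Function.Injective g := fun i j hij => Fin.ext (by rw [← hg i, ← hg j, hij])
  simpa using Nat.card_le_card_of_injective g hinj

/-- Cardinality is an isomorphism invariant, and it is unbounded on the heaps of initial segments.
-/
theorem not_fcFinite_of_isBlockSequence (hA : M.IsBlockSequence A) : ¬ M.FCFinite := by
  intro hfin
  let c : HeapClass.{u, 0} S M.Concurrent → ℕ :=
    Quotient.lift (fun E => Nat.card E.carrier) (fun _ _ ⟨φ, _⟩ => Nat.card_congr φ.toEquiv)
  obtain ⟨B, hB⟩ := (hfin.image c).bddAbove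
  have h1 := hB ⟨_, ⟨M.blockHeap hA (B + 1), isFullyCommutativeHeap_blockHeap hA _, rfl⟩, rfl⟩
  have h2 := le_card_blockHeap hA (B + 1)
  change Nat.card (M.blockHeap hA (B + 1)).carrier ≤ B at h1
  omega

end blockHeap

/-! ### Walks that turn back, and acyclicity -/

/-- `X` is a block of generators at which a walk arriving along the edge `a b` can turn back. -/
structure IsTurn {S : Type u} (M : CoxeterMatrix S) (a b : S) (X : Set S) : Prop where
  nonempty : X.Nonempty
  adj : ∀ x ∈ X, M.coxeterGraph.Adj b x
  ne : a ∉ X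
  commute : ∀ x ∈ X, ∀ y ∈ X, x ≠ y → ¬ M.Concurrent x y
  heavy : X.Nontrivial ∨ ∃ x ∈ X, M b x ≠ 3

/-- The positions of a walk that turns back at blocks. -/
inductive WalkState (S : Type u) : Type u
  | go (a b : S)
  | turn (a b : S) (X : Set S)
  | back (a b : S) (X : Set S)

/-- The block visited at a position. -/
def WalkState.block {S : Type u} : WalkState S → Set S
  | go _ b => {b}
  | turn _ _ X => X
  | back _ b _ => {b}

/-- The positions allowed for a walk along the edges in `R`. -/
inductive WalkState.Valid {S : Type u} (M : CoxeterMatrix S) (R : S → S → Prop) :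
    WalkState S → Prop
  | go {a b : S} : R a b → Valid M R (go a b)
  | turn {a b : S} {X : Set S} : R a b → M.IsTurn a b X → Valid M R (turn a b X)
  | back {a b : S} {X : Set S} : R a b → M.IsTurn a b X → Valid M R (back a b X)

/-- The steps of a walk along the edges in `R` that turns back at blocks. -/
inductive WalkState.Step {S : Type u} : WalkState S → WalkState S → Prop
  | go {a b u : S} : u ≠ a → Step (go a b) (go b u)
  | turn {a b : S} {X : Set S} : Step (go a b) (turn a b X)
  | back {a b : S} {X : Set S} : Step (turn a b X) (back a b X)
  | resume {a b : S} {X : Set S} : Step (back a b X) (go b a)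

/-- A nonempty symmetric set of edges along which one can always go on or turn back makes the
Coxeter group FC-infinite. -/
theorem not_fcFinite_of_continuation {S : Type u} [Finite S] {M : CoxeterMatrix S}
    {R : S → S → Prop} (hsymm : ∀ a b, R a b → R b a)
    (hadj : ∀ a b, R a b → M.coxeterGraph.Adj a b)
    (hcont : ∀ a b, R a b → (∃ u, u ≠ a ∧ R b u) ∨ ∃ X, M.IsTurn a b X)
    {a₀ b₀ : S} (h₀ : R a₀ b₀) : ¬ M.FCFinite := by
  have hnext : ∀ σ : {σ : WalkState S // WalkState.Valid M R σ},
      ∃ σ' : {σ : WalkState S // WalkState.Valid M R σ}, WalkState.Step σ.1 σ'.1 := by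
    rintro ⟨σ, hσ⟩
    cases hσ with
    | @go a b h =>
      rcases hcont a b h with ⟨u, hu, hR⟩ | ⟨X, hX⟩
      · exact ⟨⟨_, .go hR⟩, .go hu⟩
      · exact ⟨⟨_, .turn h hX⟩, .turn⟩
    | turn h hX => exact ⟨⟨_, .back h hX⟩, .back⟩
    | back h hX => exact ⟨⟨_, .go (hsymm _ _ h)⟩, .resume⟩
  choose next hstep' using hnext
  let τ : ℕ → {σ : WalkState S // WalkState.Valid M R σ} :=
    fun n => Nat.rec ⟨_, .go h₀⟩ (fun _ => next) n
  obtain ⟨σ, hvalid, hstep⟩ : ∃ σ : ℕ → WalkState S,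
      (∀ n, WalkState.Valid M R (σ n)) ∧ ∀ n, WalkState.Step (σ n) (σ (n + 1)) :=
    ⟨fun n => (τ n).1, fun n => (τ n).2, fun n => hstep' (τ n)⟩
  refine not_fcFinite_of_isBlockSequence (A := fun n => (σ n).block) ⟨?_, ?_, ?_, ?_⟩
  · intro n
    have h := hvalid n
    generalize σ n = p at h
    cases h with
    | go h => exact Set.singleton_nonempty _
    | turn h hX => exact hX.nonempty
    | back h hX => exact Set.singleton_nonempty _
  · intro n s hs t ht
    have h0 := hvalid n
    have h1 := hvalid (n + 1)
    have h := hstep n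
    beta_reduce at hs ht
    generalize σ n = p at h h0 hs
    generalize σ (n + 1) = q at h h1 ht
    cases h with
    | go hu =>
      cases h1 with
      | go h1 => cases hs; cases ht; exact hadj _ _ h1
    | turn =>
      cases h1 with
      | turn h1 hX => cases hs; exact hX.adj t ht
    | back =>
      cases h1 with
      | back h1 hX => cases ht; exact (hX.adj s hs).symm
    | resume =>
      cases h1 with
      | go h1 => cases hs; cases ht; exact hadj _ _ h1
  · intro n s hs t ht
    have h := hvalid n
    beta_reduce at hs ht
    generalize σ n = p at h hs ht
    cases h with
    | go h => cases hs; cases ht; exact fun h => absurd rfl h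
    | turn h hX => exact hX.commute s hs t ht
    | back h hX => cases hs; cases ht; exact fun h => absurd rfl h
  -- A generator can recur two blocks later only around a turn `b`, `X`, `b`: every other repetition
  -- is excluded by the absence of backtracking or by `a ∉ X`. The block after such a turn is `{a}`,
  -- so it misses `X`.
  · intro n s hs hs'
    have v1 := hvalid (n + 1)
    have v2 := hvalid (n + 2)
    have h1 := hstep n
    have h2 := hstep (n + 1)
    have h3 := hstep (n + 2)
    beta_reduce at hs hs' ⊢
    rw [show n + 1 + 1 = n + 2 from rfl] at h2
    rw [show n + 2 + 1 = n + 3 from rfl] at h3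
    generalize σ n = p at *
    generalize σ (n + 1) = q at *
    generalize σ (n + 2) = r at *
    generalize σ (n + 3) = w at *
    cases h1 with
    | go hu =>
      cases hs
      cases h2 with
      | go hw => exact absurd hs'.symm hw
      | turn =>
        cases v2 with
        | turn _ hX => exact absurd hs' hX.ne
    | turn =>
      cases hs
      cases v1 with
      | turn _ hX =>
        cases h2
        cases h3
        rcases hX.heavy with h | ⟨x, hx, hm⟩
        · exact Or.inl h
        · exact Or.inr ⟨x, hx, hm, fun h => hX.ne (by cases h; exact hx)⟩
    | back =>
      cases v1 with
      | back _ hX =>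
        cases h2
        cases hs'
        exact absurd hs hX.ne
    | resume =>
      cases hs
      cases h2 with
      | go hw => exact absurd hs'.symm hw
      | turn =>
        cases v2 with
        | turn _ hX => exact absurd hs' hX.ne

/-- A walk can go around a cycle forever without turning, since each vertex of the cycle has two
neighbours on it. -/
theorem isAcyclic_of_fcFinite {S : Type u} [Finite S] {M : CoxeterMatrix S} (hM : M.FCFinite) :
    M.coxeterGraph.IsAcyclic := by
  intro v c hc
  have hcont : ∀ a b, c.toSubgraph.Adj a b → ∃ u, u ≠ a ∧ c.toSubgraph.Adj b u := by
    intro a b hab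
    have h2 := hc.ncard_neighborSet_toSubgraph_eq_two (v := b)
      (c.mem_verts_toSubgraph.1 hab.snd_mem)
    obtain ⟨u, hu, hne⟩ := Set.exists_ne_of_one_lt_ncard (h2 ▸ one_lt_two) a
    exact ⟨u, hne, hu⟩
  have h0 : c.toSubgraph.Adj v c.snd := c.toSubgraph_adj_snd hc.not_nil
  exact not_fcFinite_of_continuation (R := c.toSubgraph.Adj) (fun _ _ h => h.symm)
    (fun _ _ h => h.adj_sub) (fun a b h => Or.inl (hcont a b h)) h0 hM

end CoxeterMatrix

/-! ### Neighbours of a vertex in a forest -/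

namespace SimpleGraph

/-- In an acyclic graph, distinct neighbours of a vertex `s` lie in different components of the
graph without `s`. -/
theorem IsAcyclic.not_reachable_of_adj {V : Type u} {G H : SimpleGraph V} (hG : G.IsAcyclic)
    {s t t' : V} (hH : ∀ x y, H.Adj x y → G.Adj x y ∧ x ≠ s ∧ y ≠ s) (ht : G.Adj s t)
    (ht' : G.Adj s t') (hne : t ≠ t') : ¬ H.Reachable t t' := by
  intro h
  -- A path from `t'` to `t` avoiding `s`, preceded by the edge `s t'`, would bypass the bridge `s
  -- t`.
  refine isBridge_iff.1 (isAcyclic_iff_forall_adj_isBridge.1 hG ht) ?_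
  have h1 : (G.deleteEdges {s(s, t)}).Adj s t' := by
    rw [deleteEdges_adj]
    refine ⟨ht', fun h => ?_⟩
    rcases Sym2.eq_iff.1 (Set.mem_singleton_iff.1 h) with h | h
    · exact hne h.2.symm
    · exact ht.ne h.1
  have h2 : H ≤ G.deleteEdges {s(s, t)} := by
    intro x y hxy
    obtain ⟨h3, h4, h5⟩ := hH x y hxy
    rw [deleteEdges_adj]
    refine ⟨h3, fun h => ?_⟩
    rcases Sym2.eq_iff.1 (Set.mem_singleton_iff.1 h) with h | h
    · exact h4 h.1
    · exact h5 h.2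
  exact h1.reachable.trans (h.mono h2).symm

theorem IsAcyclic.not_adj_of_adj {V : Type u} {G : SimpleGraph V} (hG : G.IsAcyclic)
    {s t t' : V} (ht : G.Adj s t) (ht' : G.Adj s t') : ¬ G.Adj t t' := fun h =>
  hG.not_reachable_of_adj (s := s)
    (H := SimpleGraph.fromRel fun x y => G.Adj x y ∧ x ≠ s ∧ y ≠ s)
    (fun x y hxy => by
      rcases hxy.2 with h | h
      · exact h
      · exact ⟨h.1.symm, h.2.2, h.2.1⟩) ht ht' h.ne
    (Adj.reachable ⟨h.ne, Or.inl ⟨h, ht.ne', ht'.ne'⟩⟩)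

end SimpleGraph

/-! ### Covering relations in heaps -/

namespace LabelledHeap

variable {P : Type u} {C : P → P → Prop} (E : LabelledHeap.{u, v} P C)

/-- A chain of concurrent comparisons from `a` to `b` contains a strict step; this lies within `[a,
b]`, so it is the covering pair itself. -/
theorem concurrent_of_covBy {a b : E.carrier} (hab : a ⋖ b) : C (E.label a) (E.label b) := by
  have key : ∀ x, Relation.TransGen (fun p q => p ≤ q ∧ C (E.label p) (E.label q)) x b → x < b →
      ∃ p q, x ≤ p ∧ p < q ∧ q ≤ b ∧ C (E.label p) (E.label q) := by
    intro x hx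
    induction hx using Relation.TransGen.head_induction_on with
    | single h => exact fun hlt => ⟨_, _, le_rfl, hlt, le_rfl, h.2⟩
    | @head x y h hy ih =>
      intro hlt
      rcases h.1.eq_or_lt with rfl | hxy
      · exact ih hlt
      · exact ⟨x, y, le_rfl, hxy, (E.le_iff_transGen _ _).2 hy, h.2⟩
  obtain ⟨p, q, hp, hpq, hq, hC⟩ := key a ((E.le_iff_transGen _ _).1 hab.le) hab.lt
  obtain rfl : a = p := hp.eq_or_lt.resolve_right fun h => hab.2 h (hpq.trans_le hq)
  obtain rfl : q = b := hq.eq_or_lt.resolve_right fun h => hab.2 hpq h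
  exact hC

theorem IsRankFunction.strictMono {E : LabelledHeap.{u, v} P C} {ρ : E.carrier → ℤ}
    (hρ : E.IsRankFunction ρ) : StrictMono ρ := by
  intro x y
  induction y using WellFoundedLT.induction with
  | ind y ih =>
    intro hxy
    obtain ⟨z, hxz, hzy⟩ := exists_le_covBy_of_lt hxy
    have h1 := hρ z y hzy
    rcases hxz.eq_or_lt with rfl | hxz
    · omega
    · have := ih z hzy.lt hxz
      omega

end LabelledHeap

namespace CoxeterMatrix

variable {S : Type u} {M : CoxeterMatrix S} {E : LabelledHeap.{u, v} S M.Concurrent}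

theorem IsFullyCommutativeHeap.adj_of_covBy (hE : M.IsFullyCommutativeHeap E) {a b : E.carrier}
    (hab : a ⋖ b) : M.coxeterGraph.Adj (E.label a) (E.label b) :=
  ⟨fun h => hE.no_square ⟨a, b, hab, h⟩, E.concurrent_of_covBy hab⟩

theorem lt_or_lt_of_label_eq {x y : E.carrier} (hne : x ≠ y) (h : E.label x = E.label y) :
    x < y ∨ y < x := by
  rcases E.comparable x y (h ▸ M.concurrent_refl _) with h | h
  · exact Or.inl (lt_of_le_of_ne h hne)
  · exact Or.inr (lt_of_le_of_ne h hne.symm)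

theorem eq_of_covBy_of_label_eq {x y b : E.carrier} (hx : x ⋖ b) (hy : y ⋖ b)
    (h : E.label x = E.label y) : x = y := by
  by_contra hne
  rcases lt_or_lt_of_label_eq hne h with h | h
  · exact hx.2 h hy.lt
  · exact hy.2 h hx.lt

/-- Over an acyclic Coxeter graph, elements with adjacent labels cover each other if neither label
occurs between them. -/
theorem IsFullyCommutativeHeap.covBy_of_forall_between (hE : M.IsFullyCommutativeHeap E)
    (hG : M.coxeterGraph.IsAcyclic) {x y : E.carrier} (hxy : x < y)
    (hadj : M.coxeterGraph.Adj (E.label x) (E.label y))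
    (hno : ∀ z, x < z → z < y → E.label z ≠ E.label x ∧ E.label z ≠ E.label y) : x ⋖ y := by
  by_contra hcov
  -- Labels along a saturated chain from `x` to `y` trace a walk in the Coxeter graph. It could use
  -- the edge between the two end labels only by stepping directly from `x` to `y`, so it bypasses a
  -- bridge.
  have key : ∀ z, x ≤ z → z ≤ y →
      (M.coxeterGraph.deleteEdges {s(E.label x, E.label y)}).Reachable (E.label x) (E.label z) := by
    intro z
    induction z using WellFoundedLT.induction with
    | ind z ih =>
      intro hxz hzy
      rcases hxz.eq_or_lt with rfl | hxz
      · exact SimpleGraph.Reachable.refl _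
      · obtain ⟨w, hxw, hwz⟩ := exists_le_covBy_of_lt hxz
        refine (ih w hwz.lt hxw (hwz.le.trans hzy)).trans (SimpleGraph.Adj.reachable ?_)
        rw [SimpleGraph.deleteEdges_adj]
        refine ⟨hE.adj_of_covBy hwz, fun h => ?_⟩
        have hends : ∀ v, x ≤ v → v ≤ y → E.label v = E.label x ∨ E.label v = E.label y →
            v = x ∨ v = y := by
          intro v h1 h2 h3
          by_contra! h4
          have := hno v (lt_of_le_of_ne h1 h4.1.symm) (lt_of_le_of_ne h2 h4.2)
          tauto
        have hw : w = x ∨ w = y := hends w hxw (hwz.le.trans hzy) (by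
          rcases Sym2.eq_iff.1 (Set.mem_singleton_iff.1 h) with h | h
          · exact Or.inl h.1
          · exact Or.inr h.1)
        have hz : z = x ∨ z = y := hends z hxz.le hzy (by
          rcases Sym2.eq_iff.1 (Set.mem_singleton_iff.1 h) with h | h
          · exact Or.inr h.2
          · exact Or.inl h.2)
        obtain rfl := hz.resolve_left hxz.ne'
        obtain rfl := hw.resolve_right hwz.ne
        exact hcov hwz
  exact SimpleGraph.isBridge_iff.1 (SimpleGraph.isAcyclic_iff_forall_adj_isBridge.1 hG hadj)
    (key y hxy.le le_rfl)

/-! ### Repeated labels lead to turns -/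

/-- From the edge `a b` one can walk without backtracking to a place to turn back. -/
inductive LeadsToTurn (M : CoxeterMatrix S) : S → S → Prop
  | turn {a b : S} {X : Set S} : M.coxeterGraph.Adj a b → M.IsTurn a b X → LeadsToTurn M a b
  | step {a b c : S} : M.coxeterGraph.Adj a b → c ≠ a → LeadsToTurn M b c → LeadsToTurn M a b

theorem LeadsToTurn.adj {a b : S} (h : M.LeadsToTurn a b) : M.coxeterGraph.Adj a b := by
  cases h <;> assumption

/-- The walk shuttles forever between the two turns. Its edges are those leading to a turn in both
directions, a set closed under going on. -/
theorem not_fcFinite_of_leadsToTurn [Finite S] {s t t' : S} (ht : M.LeadsToTurn s t)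
    (ht' : M.LeadsToTurn s t') (hne : t ≠ t') : ¬ M.FCFinite := by
  refine not_fcFinite_of_continuation (R := fun a b => M.LeadsToTurn a b ∧ M.LeadsToTurn b a)
    (fun _ _ h => h.symm) (fun _ _ h => h.1.adj) ?_
    (a₀ := s) (b₀ := t) ⟨ht, .step ht.adj.symm hne.symm ht'⟩
  rintro a b ⟨h1, h2⟩
  cases h1 with
  | turn _ hX => exact Or.inr ⟨_, hX⟩
  | step _ hc hD => exact Or.inl ⟨_, hc, hD, .step hD.adj.symm hc.symm h2⟩

/-- Two elements with the same label and no element labelled `s` between them make the edge from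
`s` to their label lead to a place to turn back. -/
theorem IsFullyCommutativeHeap.leadsToTurn (hE : M.IsFullyCommutativeHeap E)
    (hG : M.coxeterGraph.IsAcyclic) {s : S} {c d : E.carrier} (hcd : c < d)
    (hl : E.label c = E.label d) (hs : M.coxeterGraph.Adj s (E.label c))
    (hno : ∀ z ∈ Set.Icc c d, E.label z ≠ s) : M.LeadsToTurn s (E.label c) := by
  induction hn : (Set.Icc c d).ncard using Nat.strong_induction_on generalizing s c d with
  | _ n ih =>
  subst hn
  have smaller : ∀ {c' d'}, c ≤ c' → d' ≤ d → (c < c' ∨ d' < d) →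
      (Set.Icc c' d').ncard < (Set.Icc c d).ncard := by
    intro c' d' h1 h2 h3
    refine Set.ncard_lt_ncard ⟨Set.Icc_subset_Icc h1 h2, fun h => ?_⟩ (Set.toFinite _)
    rcases h3 with h3 | h3
    · exact h3.not_ge (h ⟨le_rfl, hcd.le⟩).1
    · exact h3.not_ge (h ⟨hcd.le, le_rfl⟩).2
  -- Reduction to consecutive occurrences of the label.
  by_cases hz : ∃ z, c < z ∧ z < d ∧ E.label z = E.label c
  · obtain ⟨z, h1, h2, h3⟩ := hz
    exact ih _ (smaller le_rfl h2.le (Or.inr h2)) h1 h3.symm hs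
      (fun w hw => hno w ⟨hw.1, hw.2.trans h2.le⟩) rfl
  push Not at hz
  obtain ⟨e, hce, hed⟩ := exists_covBy_le_of_lt hcd
  replace hed : e < d := lt_of_le_of_ne hed fun h => hE.no_square ⟨c, d, h ▸ hce, hl⟩
  obtain ⟨e', hce', hed'⟩ := exists_le_covBy_of_lt hcd
  replace hce' : c < e' := lt_of_le_of_ne hce' fun h => hE.no_square ⟨c, d, h ▸ hed', hl⟩
  have adj1 := hE.adj_of_covBy hce
  have adj2 := (hE.adj_of_covBy hed').symm
  rw [← hl] at adj2
  have ne1 := hno e ⟨hce.le, hed.le⟩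
  have ne2 := hno e' ⟨hce'.le, hed'.le⟩
  -- Two distinct neighbours of the label of `c`, other than `s`, form a turn: they commute because
  -- a forest has no triangle.
  have fork : ∀ {x y}, M.coxeterGraph.Adj (E.label c) x → M.coxeterGraph.Adj (E.label c) y →
      x ≠ s → y ≠ s → x ≠ y → M.LeadsToTurn s (E.label c) := by
    intro x y hx hy hxs hys hne
    have nadj := hG.not_adj_of_adj hx hy
    have hcomm : ¬ M.Concurrent x y := fun h => nadj ⟨hne, h⟩
    refine .turn hs (X := {x, y}) ⟨⟨x, by simp⟩, ?_, ?_, ?_, Or.inl ⟨x, by simp, y, by simp, hne⟩⟩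
    · rintro z (rfl | rfl) <;> assumption
    · rintro (rfl | rfl)
      · exact hxs rfl
      · exact hys rfl
    · rintro z (rfl | rfl) w (rfl | rfl) hzw
      · exact absurd rfl hzw
      · exact hcomm
      · exact fun h => hcomm (M.concurrent_symm h)
      · exact absurd rfl hzw
  by_cases hu : E.label e = E.label e'
  swap
  · exact fork adj1 adj2 ne1 ne2 hu
  by_cases hee : e = e'
  swap
  -- The smaller interval `[e, e']` again has equal end labels and avoids the label of `c`, so the
  -- walk advances by one edge.
  · have hlt : e < e' := (lt_or_lt_of_label_eq hee hu).resolve_right fun h => hce.2 hce' h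
    refine .step hs ne1 (ih _ (smaller hce.le hed'.le (Or.inl hce.lt)) hlt hu adj1 ?_ rfl)
    exact fun z hz' => hz z (hce.lt.trans_le hz'.1) (hz'.2.trans_lt hed'.lt)
  subst hee
  by_cases hup : ∃ z, c ⋖ z ∧ z < d ∧ z ≠ e
  · obtain ⟨z, hcz, hzd, hne⟩ := hup
    refine fork adj1 (hE.adj_of_covBy hcz) ne1 (hno z ⟨hcz.le, hzd.le⟩) fun h => ?_
    rcases lt_or_lt_of_label_eq hne h.symm with h | h
    · exact hce.2 hcz.lt h
    · exact hcz.2 hce.lt h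
  push Not at hup
  have huniq : ∀ z, c < z → z < d → z = e := by
    intro z h1 h2
    obtain ⟨w, hcw, hwz⟩ := exists_covBy_le_of_lt h1
    obtain rfl := hup w hcw (hwz.trans_lt h2)
    exact hwz.eq_or_lt.elim Eq.symm fun h => absurd h2 (hed'.2 h)
  -- Now `[c, d]` is `{c, e, d}`. Since m = 3 would make it a forbidden convex chain, the single
  -- label of `e` is already a turn.
  refine .turn hs (X := {E.label e}) ⟨⟨_, rfl⟩, ?_, ne1.symm, ?_, Or.inr ⟨_, rfl, fun hm => ?_⟩⟩
  · rintro _ rfl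
    exact adj1
  · rintro _ rfl _ rfl h
    exact absurd rfl h
  · refine hE.no_braid (E.label c) (E.label e) hm.ge ?_
    rw [hm]
    refine ⟨![c, e, d], ⟨?_, ?_⟩, ?_⟩
    · rw [Fin.strictMono_iff_lt_succ]
      intro i
      fin_cases i
      · exact hce.lt
      · exact hed
    · intro z i j hi hj
      have h1 : ∀ i, c ≤ ![c, e, d] i := by
        intro i
        fin_cases i
        exacts [le_rfl, hce.le, hcd.le]
      have h2 : ∀ i, ![c, e, d] i ≤ d := by
        intro i
        fin_cases i
        exacts [hcd.le, hed.le, le_rfl]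
      exact ⟨1, (huniq z ((h1 i).trans_lt hi) (hj.trans_le (h2 j))).symm⟩
    · intro i
      fin_cases i
      · simp
      · simp
      · simp [hl]

/-! ### From a rank function to the labels -/

/-- In a ranked heap, the elements of `S_{[a, b]}` have equal or pairwise distinct labels. -/
theorem IsFullyCommutativeHeap.labels_of_isRanked [Finite S] (hM : M.FCFinite)
    (hE : M.IsFullyCommutativeHeap E) (hr : E.IsRanked) {a b : E.carrier}
    (hab : E.IsMinimalBalanced a b) :
    (∀ c ∈ E.concurrentSet a b, ∀ d ∈ E.concurrentSet a b, E.label c = E.label d) ∨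
    (∀ c ∈ E.concurrentSet a b, ∀ d ∈ E.concurrentSet a b, c ≠ d → E.label c ≠ E.label d) := by
  obtain ⟨ρ, hρ⟩ := hr
  have hG := isAcyclic_of_fcFinite hM
  obtain ⟨⟨hle, hl⟩, hne, hmin⟩ := hab
  have hin : ∀ z ∈ E.concurrentSet a b, a < z ∧ z < b := by
    rintro z ⟨⟨h1, h2⟩, h3, -⟩
    exact ⟨lt_of_le_of_ne h1 fun h => h3 (h ▸ rfl), lt_of_le_of_ne h2 fun h => h3 (by rw [h, hl])⟩
  have hlab : ∀ z, a < z → z < b → E.label z ≠ E.label a := by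
    intro z h1 h2 h3
    rcases hmin z ⟨h1.le, h2.le⟩ h3 with rfl | rfl
    · exact lt_irrefl _ h1
    · exact lt_irrefl _ h2
  have leads : ∀ c ∈ E.concurrentSet a b, ∀ d ∈ E.concurrentSet a b, c ≠ d →
      E.label c = E.label d →
      M.LeadsToTurn (E.label a) (E.label c) ∧ ρ a + 3 ≤ ρ b := by
    have main : ∀ c ∈ E.concurrentSet a b, ∀ d ∈ E.concurrentSet a b, c < d →
        E.label c = E.label d → M.LeadsToTurn (E.label a) (E.label c) ∧ ρ a + 3 ≤ ρ b := by
      intro c hc d hd hcd hcdl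
      refine ⟨hE.leadsToTurn hG hcd hcdl hc.2 fun z hz => ?_, ?_⟩
      · exact hlab z ((hin c hc).1.trans_le hz.1) (hz.2.trans_lt (hin d hd).2)
      · have h1 := hρ.strictMono (hin c hc).1
        have h2 := hρ.strictMono hcd
        have h3 := hρ.strictMono (hin d hd).2
        omega
    intro c hc d hd hcd hcdl
    rcases lt_or_lt_of_label_eq hcd hcdl with h | h
    · exact main c hc d hd h hcdl
    · exact hcdl ▸ main d hd c hc h hcdl.symm
  by_contra! hcon
  obtain ⟨⟨p, hp, q, hq, hpq⟩, c, hc, d, hd, hcd, hcdl⟩ := hcon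
  obtain ⟨hturn, hrank⟩ := leads c hc d hd hcd hcdl
  obtain ⟨e, he, hec⟩ : ∃ e ∈ E.concurrentSet a b, E.label c ≠ E.label e := by
    by_cases h : E.label c = E.label p
    · exact ⟨q, hq, h ▸ hpq⟩
    · exact ⟨p, hp, h⟩
  by_cases hrep : ∃ e' ∈ E.concurrentSet a b, e ≠ e' ∧ E.label e = E.label e'
  · obtain ⟨e', he', h1, h2⟩ := hrep
    exact not_fcFinite_of_leadsToTurn hturn (leads e he e' he' h1 h2).1 hec hM
  · push Not at hrep
    -- The label of `e` occurs once, hence `a ⋖ e ⋖ b`, and the rank rises by 2 instead of at least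
    -- 3.
    have hother : ∀ z, a < z → z < b → z ≠ e → E.label z ≠ E.label e := fun z h1 h2 h3 h4 =>
      hrep z ⟨⟨h1.le, h2.le⟩, h4 ▸ he.2⟩ h3.symm h4.symm
    obtain ⟨hae, heb⟩ := hin e he
    have cov1 : a ⋖ e := hE.covBy_of_forall_between hG hae he.2 fun z h1 h2 =>
      ⟨hlab z h1 (h2.trans heb), hother z h1 (h2.trans heb) h2.ne⟩
    have cov2 : e ⋖ b := hE.covBy_of_forall_between hG heb
      (by rw [← hl]; exact SimpleGraph.Adj.symm he.2) fun z h1 h2 =>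
        ⟨hother z (hae.trans h1) h2 h1.ne', hl ▸ hlab z (hae.trans h1) h2⟩
    have h1 := hρ _ _ cov1
    have h2 := hρ _ _ cov2
    omega

/-! ### From the labels to a rank function -/

/-- A rank function below a new element `b` can be chosen constant on the elements covered by `b`. -/
theorem IsFullyCommutativeHeap.exists_constant_on_covered (hE : M.IsFullyCommutativeHeap E)
    (hG : M.coxeterGraph.IsAcyclic) (hlabels : ∀ a b : E.carrier, E.IsMinimalBalanced a b →
      (∀ c ∈ E.concurrentSet a b, ∀ d ∈ E.concurrentSet a b, E.label c = E.label d) ∨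
      (∀ c ∈ E.concurrentSet a b, ∀ d ∈ E.concurrentSet a b, c ≠ d → E.label c ≠ E.label d))
    {I : Set E.carrier} (hI : IsLowerSet I) {b : E.carrier} (hbI : b ∉ I)
    (hb : ∀ x < b, x ∈ I) {ρ : E.carrier → ℤ}
    (hρ : ∀ x ∈ I, ∀ y ∈ I, x ⋖ y → ρ y = ρ x + 1) :
    ∃ (ρ' : E.carrier → ℤ) (r : ℤ), (∀ x ∈ I, ∀ y ∈ I, x ⋖ y → ρ' y = ρ' x + 1) ∧
      ∀ x, x ⋖ b → ρ' x = r := by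
  classical
  by_cases hs : ∃ a ∈ I, E.label a = E.label b
  · have hbelow : ∀ a ∈ I, E.label a = E.label b → a < b := by
      intro a ha hl
      refine (lt_or_lt_of_label_eq (by rintro rfl; exact hbI ha) hl).resolve_right fun h => ?_
      exact hbI (hI h.le ha)
    obtain ⟨a, ⟨haI, hal⟩, hmax⟩ :=
      (Set.toFinite {a | a ∈ I ∧ E.label a = E.label b}).exists_maximal hs
    have hab := hbelow a haI hal
    have hlab : ∀ z, a < z → z < b → E.label z ≠ E.label a := fun z h1 h2 h3 =>
      h1.not_ge (hmax ⟨hb z h2, h3.trans hal⟩ h1.le)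
    have hmin : E.IsMinimalBalanced a b := by
      refine ⟨⟨hab.le, hal⟩, hab.ne, fun c hc hcl => ?_⟩
      by_contra! h
      exact hlab c (lt_of_le_of_ne hc.1 h.1.symm) (lt_of_le_of_ne hc.2 h.2) hcl
    have hcov : ∀ x, x ⋖ b → a < x ∧ x ∈ E.concurrentSet a b := by
      intro x hx
      have hadj := (hE.adj_of_covBy hx).symm
      rw [← hal] at hadj
      have hax : a < x := by
        rcases E.comparable a x hadj.2 with h | h
        · exact lt_of_le_of_ne h fun h => hadj.1 (h ▸ rfl)
        · exact absurd hab (hx.2 (lt_of_le_of_ne h fun h => hadj.1 (h ▸ rfl)))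
      exact ⟨hax, ⟨hax.le, hx.le⟩, hadj⟩
    rcases hlabels a b hmin with h | h
    -- Elements covered by `b` with equal labels coincide, so `b` covers only `x`.
    · obtain ⟨x, -, hx⟩ := exists_le_covBy_of_lt hab
      refine ⟨ρ, ρ x, hρ, fun y hy => ?_⟩
      rw [eq_of_covBy_of_label_eq hy hx (h y (hcov y hy).2 x (hcov x hx).2)]
    -- With distinct labels, neither the label of `a` nor that of `x` recurs strictly between `a`
    -- and `x`, so every `x` covered by `b` covers `a`.
    · refine ⟨ρ, ρ a + 1, hρ, fun x hx => hρ a haI x (hb x hx.lt) ?_⟩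
      obtain ⟨hax, hxS⟩ := hcov x hx
      refine hE.covBy_of_forall_between hG hax hxS.2 fun z h1 h2 =>
        ⟨hlab z h1 (h2.trans hx.lt), fun h3 => ?_⟩
      exact h z ⟨⟨h1.le, (h2.trans hx.lt).le⟩, h3 ▸ hxS.2⟩ x hxS h2.ne h3
  · push Not at hs
    let H : SimpleGraph S := SimpleGraph.mk
      (fun p q => M.coxeterGraph.Adj p q ∧ p ≠ E.label b ∧ q ≠ E.label b)
      ⟨fun _ _ h => ⟨h.1.symm, h.2.2, h.2.1⟩⟩ ⟨fun _ h => h.1.ne rfl⟩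
    -- The shift on each component of `H` is the rank of the element covered by `b` whose label lies
    -- there; that element is unique because distinct neighbours of the label of `b` lie in distinct
    -- components. Other components are not shifted.
    let c : S → ℤ := fun p =>
      if h : ∃ x, x ⋖ b ∧ H.Reachable (E.label x) p then ρ h.choose else 0
    have hc1 : ∀ x, x ⋖ b → c (E.label x) = ρ x := by
      intro x hx
      have h : ∃ y, y ⋖ b ∧ H.Reachable (E.label y) (E.label x) := ⟨x, hx, .refl _⟩
      have h2 : c (E.label x) = ρ h.choose := dif_pos h
      rw [h2]
      congr 1
      refine eq_of_covBy_of_label_eq h.choose_spec.1 hx ?_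
      by_contra hne
      exact hG.not_reachable_of_adj (H := H) (fun _ _ h => h)
        (hE.adj_of_covBy h.choose_spec.1).symm (hE.adj_of_covBy hx).symm hne h.choose_spec.2
    have hc2 : ∀ p q, H.Adj p q → c p = c q := by
      intro p q hpq
      have : (fun x => x ⋖ b ∧ H.Reachable (E.label x) p) =
          fun x => x ⋖ b ∧ H.Reachable (E.label x) q := by
        funext x
        exact propext ⟨fun h => ⟨h.1, h.2.trans hpq.reachable⟩,
          fun h => ⟨h.1, h.2.trans hpq.symm.reachable⟩⟩
      simp only [c, this]
    refine ⟨fun x => ρ x - c (E.label x), 0, fun x hx y hy hxy => ?_, fun x hx => ?_⟩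
    · have h1 := hρ x hx y hy hxy
      have h2 := hc2 (E.label x) (E.label y) ⟨hE.adj_of_covBy hxy, hs x hx, hs y hy⟩
      simp only
      omega
    · simp only [hc1 x hx, sub_self]

/-- Induction on the size of a lower set, removing a maximal element `b`. Extending the rank to `b`
only requires agreement on the elements that `b` covers. -/
theorem IsFullyCommutativeHeap.isRanked_of_labels (hE : M.IsFullyCommutativeHeap E)
    (hG : M.coxeterGraph.IsAcyclic) (hlabels : ∀ a b : E.carrier, E.IsMinimalBalanced a b →
      (∀ c ∈ E.concurrentSet a b, ∀ d ∈ E.concurrentSet a b, E.label c = E.label d) ∨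
      (∀ c ∈ E.concurrentSet a b, ∀ d ∈ E.concurrentSet a b, c ≠ d → E.label c ≠ E.label d)) :
    E.IsRanked := by
  classical
  have key : ∀ (n : ℕ) (I : Set E.carrier), I.ncard = n → IsLowerSet I →
      ∃ ρ : E.carrier → ℤ, ∀ x ∈ I, ∀ y ∈ I, x ⋖ y → ρ y = ρ x + 1 := by
    intro n
    induction n with
    | zero =>
      intro I hn _
      rw [(Set.ncard_eq_zero (Set.toFinite I)).1 hn]
      exact ⟨0, fun x hx => absurd hx (Set.notMem_empty x)⟩
    | succ n ih =>
      intro I hn hI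
      obtain ⟨b, hbI, hmax⟩ := (Set.toFinite I).exists_maximal
        (Set.nonempty_of_ncard_ne_zero (by omega))
      have hlow : IsLowerSet (I \ {b}) := by
        rintro x y hyx ⟨hx, hxb⟩
        refine ⟨hI hyx hx, fun hy => hxb ?_⟩
        obtain rfl : y = b := hy
        exact le_antisymm (hmax hx hyx) hyx
      obtain ⟨ρ, hρ⟩ := ih (I \ {b}) (by rw [Set.ncard_sdiff_singleton_of_mem hbI]; omega) hlow
      obtain ⟨ρ', r, h1, h2⟩ := hE.exists_constant_on_covered hG hlabels hlow (b := b)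
        (fun h => h.2 rfl) (fun x hx => ⟨hI hx.le hbI, hx.ne⟩) hρ
      refine ⟨Function.update ρ' b (r + 1), fun x hx y hy hxy => ?_⟩
      have hxb : x ≠ b := by
        rintro rfl
        exact hxy.lt.not_ge (hmax hy hxy.le)
      rw [Function.update_of_ne hxb]
      by_cases hyb : y = b
      · subst hyb
        rw [Function.update_self, h2 x hxy]
      · rw [Function.update_of_ne hyb]
        exact h1 x ⟨hx, hxb⟩ y ⟨hy, hyb⟩ hxy
  obtain ⟨ρ, hρ⟩ := key _ Set.univ rfl isLowerSet_univ
  exact ⟨ρ, fun x y => hρ x trivial y trivial⟩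

end CoxeterMatrix

theorem theorem3p2p3 {S : Type u} [Finite S] (M : CoxeterMatrix S) (hM : M.FCFinite)
    (E : LabelledHeap.{u, v} S M.Concurrent) (hE : M.IsFullyCommutativeHeap E) :
    E.IsRanked ↔
      ∀ a b : E.carrier, E.IsMinimalBalanced a b →
        (∀ c ∈ E.concurrentSet a b, ∀ d ∈ E.concurrentSet a b, E.label c = E.label d) ∨
        (∀ c ∈ E.concurrentSet a b, ∀ d ∈ E.concurrentSet a b, c ≠ d → E.label c ≠ E.label d) :=
  ⟨fun hr _ _ hab => hE.labels_of_isRanked hM hr hab,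
    hE.isRanked_of_labels (CoxeterMatrix.isAcyclic_of_fcFinite hM)⟩
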